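/- Let $\mathbb K$ be a field and let $q,t$ be indeterminates. Let $\mathbf{FQSym}$ be the algebra of free quasi-symmetric functions over $\mathbb K(t)$, with basis $\mathbf G_\sigma$ ($\sigma\in\mathfrak S_n$, $n\ge 0$), product $\mathbf G_\alpha\mathbf G_\beta=\sum\mathbf G_\gamma$ over all permutations $\gamma=u\cdot v$ with $\mathrm{std}(u)=\alpha$, $\mathrm{std}(v)=\beta$, internal product $\mathbf G_\sigma*\mathbf G_\tau=\mathbf G_{\tau\circ\sigma}$ (zero if the sizes differ), scalar product $(\mathbf G_\sigma,\mathbf G_\tau)=\delta_{\sigma,\tau^{-1}}$ and dual basis $\mathbf F_\sigma=\mathbf G_{\sigma^{-1}}$. Put $S_n=\mathbf G_{12\cdots n}$, $\Lambda_n=\mathbf G_{n\cdots 21}$ and $\mathbf G_\sigma((1-t)A)=\mathbf G_\sigma*\sum_{k+l=n}(-t)^k\Lambda_kS_l$ for $\sigma\in\mathfrak S_n$, and let $f\mapsto f(A\cdot(1-t))$ be the adjoint of the linear map $\mathbf G_\sigma\mapsto\mathbf G_\sigma((1-t)A)$. The specialization $f(\mathbb X)\in\mathbb K(t)[[q]]\subset\mathbb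 K(t)((q))$ of $f\in\mathbf{FQSym}$ at $\mathbb X=\frac1{1-q}\,\hat\times\,(1-t)$ is obtained by applying to $f(A\cdot(1-t))$ the linear map $\mathbf F_\sigma\mapsto F_{D(\sigma)}\bigl(\tfrac1{1-q}\bigr)=\sum q^{a_1+\cdots+a_n}$, the sum being over all integers $a_1\ge a_2\ge\cdots\ge a_n\ge0$ with $a_i>a_{i+1}$ whenever $\sigma_i>\sigma_{i+1}$ (Gessel's fundamental quasi-symmetric function evaluated at the ordered alphabet $\cdots<q^2<q<1$). For a binary tree $T$ with $\#T$ nodes let $\mathbf P_T=\sum_{P(\sigma)=T}\mathbf F_\sigma$, where $P(\sigma)$ is the shape of the binary search tree obtained by inserting the letters of $\sigma$ from right to left. (1) Let $T$ be a nonempty binary tree with $n$ nodes, let $T_1$ and $T_2$ be its left and right subtrees, and let $T_2'$ be the left subtree of $T_2$ (empty if $T_2$ is empty). Then $$\mathbf P_T(\mathbb X)=\frac{(q^{\#T_2}-q^{\#T_2'}t)(1-q^{\#T_1}t)}{(1-q^{\#T_2'}t)(1-q^n)}\,\mathbf P_{T_1}(\mathbb X)\,\mathbf P_{T_2}(\mathbb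 X).$$ (2) For every binary tree $T$, $\mathbf P_T(\mathbb X)$ is the product over all nodes $s$ of $T$ of the factors $$\frac1{1-q^{n_s}}\cdot\begin{cases}q^{n'}-q^{n''}t&\text{if } s \text{ has a right son},\\ 1-q^{n_s-1}t&\text{if } s \text{ has no right son and is not the right son of its father},\\ 1-q^{d}t&\text{if } s\text{ has no right son and is the right son of its father},\end{cases}$$ where $n_s$ is the size of the subtree rooted at $s$, $n'$ is the size of the right subtree of $s$, $n''$ is the size of the left subtree of the right subtree of $s$, and $d$ is the size of the left subtree of the topmost ancestor of $s$ from which $s$ is reached only by right branches. -/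

import Mathlib

open Equiv

noncomputable section

namespace SuperHook

/-! ### Free quasi-symmetric functions -/

/-- The underlying module of `FQSym` over `K`: finitely supported families of coordinates on the
basis `G_σ`, where `σ` runs over the permutations of `Fin n` for all `n`.
A permutation is identified with the word `σ 0, σ 1, …, σ (n - 1)`. -/
abbrev FQSym (K : Type*) [CommRing K] : Type _ := (Σ n : ℕ, Perm (Fin n)) →₀ K

section FQSym

variable (K : Type*) [CommRing K]

/-- The basis element `G_σ`. -/
def G {n : ℕ} (σ : Perm (Fin n)) : FQSym K := Finsupp.single ⟨n, σ⟩ 1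

/-- The dual basis element `F_σ = G_{σ⁻¹}`. -/
def F {n : ℕ} (σ : Perm (Fin n)) : FQSym K := G K σ⁻¹

/-- `γ = u · v` with `std u = α` and `std v = β` (words without repeated letters have the same
standardization iff their letters are in the same relative order). -/
def IsConvolution {k l : ℕ} (α : Perm (Fin k)) (β : Perm (Fin l)) (γ : Perm (Fin (k + l))) :
    Prop :=
  (∀ i j, γ (Fin.castAdd l i) < γ (Fin.castAdd l j) ↔ α i < α j) ∧
    ∀ i j, γ (Fin.natAdd k i) < γ (Fin.natAdd k j) ↔ β i < β j

variable {K}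

open Classical in
/-- The product of `FQSym`: `G_α G_β` is the sum of the `G_γ` with `γ = u · v`, `std u = α`,
`std v = β`. -/
def mul (f g : FQSym K) : FQSym K :=
  f.sum fun a x => g.sum fun b y =>
    (x * y) • ∑ γ : Perm (Fin (a.1 + b.1)) with IsConvolution a.2 b.2 γ, G K γ

/-- The internal product of `FQSym`: `G_σ * G_τ = G_{τ ∘ σ}` if `σ` and `τ` have the same size,
and `0` otherwise. -/
def internalMul (f g : FQSym K) : FQSym K :=
  f.sum fun a x => g.sum fun b y =>
    if h : a.1 = b.1 then (x * y) • G K (b.2 * (finCongr h).permCongr a.2) else 0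

/-- The scalar product of `FQSym`, for which `(G_σ, G_τ) = δ_{σ, τ⁻¹}`. -/
def pairing (f g : FQSym K) : K := f.sum fun a x => x * g ⟨a.1, a.2⁻¹⟩

variable (K)

/-- The noncommutative complete function `S_n = G_{12⋯n}`. -/
def S (n : ℕ) : FQSym K := G K (1 : Perm (Fin n))

/-- The noncommutative elementary function `Λ_n = G_{n⋯21}`. -/
def Lam (n : ℕ) : FQSym K := G K (Fin.revPerm : Perm (Fin n))

variable {K}

/-- `S_n((1 - t)A)`, the component of degree `n` of `σ_1((1 - t)A) = λ_{-t}(A) σ_1(A)`. -/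
def SOneSub (t : K) (n : ℕ) : FQSym K :=
  ∑ p ∈ Finset.HasAntidiagonal.antidiagonal n, (-t) ^ p.1 • mul (Lam K p.1) (S K p.2)

/-- `G_σ((1 - t)A) = G_σ(A) * σ_1((1 - t)A)`. -/
def GOneSub (t : K) {n : ℕ} (σ : Perm (Fin n)) : FQSym K :=
  internalMul (G K σ) (SOneSub t n)

/-- `f(A·(1 - t))`: the adjoint, for the scalar product of `FQSym`, of the linear map
`G_β ↦ G_β((1 - t)A)`, applied to `f`. It is given on the basis by
`F_σ(A·(1 - t)) = ∑_β (F_σ, G_β((1 - t)A)) F_β`. Here `F_σ` is `G_{σ⁻¹}`, so the coordinate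
`x` of `f` on `G_a` is its coordinate on `F_{a⁻¹}`. -/
def dualOneSub (t : K) (f : FQSym K) : FQSym K :=
  f.sum fun a x =>
    x • ∑ β : Perm (Fin a.1), pairing (F K a.2⁻¹) (GOneSub t β) • F K β

end FQSym

/-! ### Quasi-symmetric functions and the alphabet `1/(1 - q)` -/

section QSym

variable (K : Type*) [CommRing K]

/-- Gessel's fundamental quasi-symmetric function `F_{D(σ)}` over the totally ordered alphabet
`(x_i)_{i ∈ ι}`: the sum of the monomials `x_{s_1} ⋯ x_{s_n}` with `s_1 ≤ ⋯ ≤ s_n` and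
`s_i < s_{i+1}` whenever `σ_i > σ_{i+1}`. -/
def gesselF (ι : Type*) [LinearOrder ι] {n : ℕ} (σ : Perm (Fin n)) : MvPowerSeries ι K :=
  fun m => (Set.ncard {s : Fin n → ι | Monotone s ∧
    (∀ i j : Fin n, (j : ℕ) = i + 1 → σ j < σ i → s i < s j) ∧
    ∑ i, Finsupp.single (s i) 1 = m} : K)

variable {K}

/-- Evaluation of a series of bounded degree at the alphabet `1/(1 - q) = {⋯ < q² < q < 1}`,
that is `x_i ↦ q^i`. The order of this alphabet is the one for which
`σ_1(A/(1 - q)) = ⋯ σ_{q²}(A) σ_q(A) σ_1(A)`, so the index set is `ℕ` with its order reversed.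
The variable `q` is the power series variable. -/
def evalGeom (f : MvPowerSeries ℕᵒᵈ K) : PowerSeries K :=
  PowerSeries.mk fun N =>
    ∑ᶠ (m : ℕᵒᵈ →₀ ℕ) (_ : (m.sum fun i a => OrderDual.ofDual i * a) = N), MvPowerSeries.coeff m f

/-- The specialization `A = 1/(1 - q)` of an element of `FQSym`: the linear map
`F_σ ↦ F_{D(σ)}(1/(1 - q))`. -/
def specGeom (f : FQSym K) : PowerSeries K :=
  f.sum fun a x => x • evalGeom (gesselF K ℕᵒᵈ a.2⁻¹)

/-- The specialization `f(𝕏)` at `𝕏 = 1/(1 - q) ×̂ (1 - t)`. -/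
def specX (t : K) (f : FQSym K) : PowerSeries K := specGeom (dualOneSub t f)

end QSym

/-! ### Binary trees -/

/-- Insertion of a letter in a binary search tree. -/
def bstInsert (x : ℕ) : BinaryTree ℕ → BinaryTree ℕ
  | .nil => .node x .nil .nil
  | .node y l r => if x ≤ y then .node y (bstInsert x l) r else .node y l (bstInsert x r)

/-- `P(σ)`: the shape of the binary search tree of `σ`, obtained by inserting the letters of the
word `σ` from right to left (so that the last letter is at the root, and `P(σ)` is the shape of
the decreasing tree of `σ⁻¹`). -/
def bstShape {n : ℕ} (σ : Perm (Fin n)) : BinaryTree Unit :=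
  ((List.ofFn fun i => (σ i : ℕ)).foldr bstInsert .nil).map fun _ => ()

/-- The element `P_T = ∑_{P(σ) = T} F_σ` of the Loday–Ronco algebra, in `FQSym`. -/
def P (K : Type*) [CommRing K] (T : BinaryTree Unit) : FQSym K :=
  ∑ σ : Perm (Fin T.numNodes) with bstShape σ = T, F K σ

/-! ### The field of coefficients: Laurent series in `q` over the field `𝕜(t)` -/

section Coefficients

variable (𝕜 : Type*) [Field 𝕜]

/-- The indeterminate `q`. -/
def q : LaurentSeries (RatFunc 𝕜) := HahnSeries.ofPowerSeries ℤ (RatFunc 𝕜) PowerSeries.X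

/-- The indeterminate `t`. -/
def t : LaurentSeries (RatFunc 𝕜) := HahnSeries.C RatFunc.X

/-- `P_T(𝕏)`. -/
def PX (T : BinaryTree Unit) : LaurentSeries (RatFunc 𝕜) :=
  HahnSeries.ofPowerSeries ℤ (RatFunc 𝕜) (specX (RatFunc.X : RatFunc 𝕜) (P (RatFunc 𝕜) T))

end Coefficients

/-! ### Nodes and hook-contents -/

/-- The nodes of a tree, encoded by the path from the root: `false` is a step to the left son,
`true` a step to the right son. -/
def nodes : BinaryTree Unit → Finset (List Bool)
  | .nil => ∅
  | .node _ l r => {[]} ∪ (nodes l).image (List.cons false) ∪ (nodes r).image (List.cons true)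

/-- The subtree rooted at the end of a path. -/
def subtreeAt : BinaryTree Unit → List Bool → BinaryTree Unit
  | T, [] => T
  | T, b :: s => subtreeAt (if b then T.right else T.left) s

/-- The topmost ancestor of `s` (possibly `s` itself) from which `s` is reached only by right
branches: all the final right steps of the path are removed. -/
def topAncestor (s : List Bool) : List Bool := s.rdropWhile fun b => b

/-- The `(q,t)`-hook-content factor of the node `s` of `T`. -/
def hookContent (𝕜 : Type*) [Field 𝕜] (T : BinaryTree Unit) (s : List Bool) :
    LaurentSeries (RatFunc 𝕜) :=
  let U := subtreeAt T s
  1 / (1 - q 𝕜 ^ U.numNodes) *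
    (if U.right ≠ .nil then
      q 𝕜 ^ U.right.numNodes - q 𝕜 ^ U.right.left.numNodes * t 𝕜
    else if s.getLast? = some true then
      1 - q 𝕜 ^ (subtreeAt T (topAncestor s)).left.numNodes * t 𝕜
    else
      1 - q 𝕜 ^ (U.numNodes - 1) * t 𝕜)

end SuperHook

end

/-! The proof turns `P_T(𝕏)` into a generating series of labelled trees. Each node carries a value
`j` and possibly a bar, with weight `q^j`, times `-t` if it is barred.

The coefficient of `σ_1((1 - t)A)` at `τ` counts, with sign and weight, the ways of barring letters
so that `τ` lists the barred letters in decreasing order and then the others in increasing order: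
`τ` is sorted for `signedLabel` (`sum_isValley`). The sequences defining `F_{D(β)}(1/(1 - q))`
supply the values. Together they say that `F_σ(𝕏)` sums over the labellings of the letters whose
keys (value decreasing, then signed label) are sorted by `σ` (`coeff_specX_F`). Every labelling is
sorted by exactly one `σ`, and `P(σ) = T` exactly when the keys, read in infix order, make `T` a
decreasing tree (`bstShape_eq_iff`). Hence `P_T(𝕏)` sums over decreasing labellings of `T`
(`coeff_specX_P`).

Decreasingness is a local condition between father and son, so it only imposes lower bounds on the
root of each subtree: `a` if that root is unbarred, `b` if barred. Raising all values by `k`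
multiplies the weight by `q^(k·#T)`, so the sum over the root value is geometric and the series is
`(q^(a·#T) - t·q^(b·#T + #left))·A`, where `A` does not depend on `a` and `b`
(`X_pow_dvd_treeSum_sub`). The left subtree inherits equal bounds, the right one the bounds `(j + 1,
j)`; comparing `(1, 0)` with `(0, 0)` for the right subtree gives formula (1).

For (2), the denominator `1 - q^(#T_2')t` cancels the numerator factor that the right son
contributes. Along a right branch only the factor of the top node survives, and it is credited to
the bottom node (`prod_hookContent_eq`). -/

namespace SuperHook

open scoped Classical

/-! ### The specialization of a basis element -/

section Coordinates

variable {K : Type*} [CommRing K]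

/-- `τ` is decreasing on its first `k` positions and increasing on the others. -/
def IsValley {n : ℕ} (k : ℕ) (τ : Perm (Fin n)) : Prop :=
  ∀ i j : Fin n, i < j → ((j : ℕ) < k → τ j < τ i) ∧ (k ≤ (i : ℕ) → τ i < τ j)

/-- The sequences `a` contributing to the fundamental quasi-symmetric function `F_{D(β)}` at the
alphabet `1/(1 - q)`. -/
def Admissible {n : ℕ} (β : Perm (Fin n)) (a : Fin n → ℕ) : Prop :=
  Antitone a ∧ ∀ i j : Fin n, (j : ℕ) = i + 1 → β j < β i → a j < a i

lemma isConvolution_rev_one {k l : ℕ} (γ : Perm (Fin (k + l))) :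
    IsConvolution (Fin.revPerm : Perm (Fin k)) (1 : Perm (Fin l)) γ ↔ IsValley k γ := by
  constructor
  · rintro ⟨h₁, h₂⟩ i j hij
    constructor
    · intro hj
      have := (h₁ ⟨j, hj⟩ ⟨i, lt_trans hij hj⟩).2 (by simpa using hij)
      exact this
    · intro hi
      have hij' : (i : ℕ) < j := hij
      have := (h₂ ⟨i - k, by omega⟩ ⟨j - k, by omega⟩).2
        (by simp only [Perm.coe_one, id, Fin.mk_lt_mk]; omega)
      convert this using 2 <;> ext <;> simp <;> omega
  · intro h
    constructor
    · intro i j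
      rcases lt_trichotomy i j with hij | rfl | hij
      · have := (h (Fin.castAdd l i) (Fin.castAdd l j) hij).1 (by simp)
        simp [this.not_gt, hij.not_gt]
      · simp
      · have := (h (Fin.castAdd l j) (Fin.castAdd l i) hij).1 (by simp)
        simp [this, hij]
    · intro i j
      rcases lt_trichotomy i j with hij | rfl | hij
      · have := (h (Fin.natAdd k i) (Fin.natAdd k j) (by simpa using hij)).2 (by simp)
        simp [this, hij]
      · simp
      · have := (h (Fin.natAdd k j) (Fin.natAdd k i) (by simpa using hij)).2 (by simp)
        simp [this.not_gt, hij.not_gt]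

lemma mul_G_G {k l : ℕ} (α : Perm (Fin k)) (β : Perm (Fin l)) :
    mul (G K α) (G K β) = ∑ γ : Perm (Fin (k + l)) with IsConvolution α β γ, G K γ := by
  unfold mul G
  rw [Finsupp.sum_single_index (by simp), Finsupp.sum_single_index (by simp)]
  simp

lemma G_apply {n : ℕ} (σ τ : Perm (Fin n)) : G K σ ⟨n, τ⟩ = if σ = τ then 1 else 0 := by
  simp [G, Finsupp.single_apply]

lemma mul_Lam_S_apply {n k l : ℕ} (h : k + l = n) (τ : Perm (Fin n)) :
    mul (Lam K k) (S K l) ⟨n, τ⟩ = if IsValley k τ then 1 else 0 := by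
  subst h
  rw [Lam, S, mul_G_G, Finsupp.finsetSum_apply, Finset.sum_filter]
  simp_rw [isConvolution_rev_one, G_apply]
  rw [Finset.sum_eq_single τ]
  · simp
  · intro γ _ h; simp [h]
  · simp

lemma SOneSub_apply (t : K) {n : ℕ} (τ : Perm (Fin n)) :
    SOneSub t n ⟨n, τ⟩ = ∑ k ∈ Finset.range (n + 1), if IsValley k τ then (-t) ^ k else 0 := by
  rw [SOneSub, Finsupp.finsetSum_apply,
    ← Finset.Nat.sum_antidiagonal_eq_sum_range_succ
      (fun k _ => if IsValley k τ then (-t) ^ k else 0)]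
  refine Finset.sum_congr rfl fun p hp => ?_
  rw [Finsupp.smul_apply, mul_Lam_S_apply (Finset.HasAntidiagonal.mem_antidiagonal.1 hp)]
  simp

lemma internalMul_G_apply {n : ℕ} (β σ : Perm (Fin n)) (g : FQSym K) :
    internalMul (G K β) g ⟨n, σ⟩ = g ⟨n, σ * β⁻¹⟩ := by
  unfold internalMul G
  rw [Finsupp.sum_single_index (by simp [Finsupp.sum]), Finsupp.sum, Finsupp.finsetSum_apply,
    Finset.sum_eq_single ⟨n, σ * β⁻¹⟩]
  · have : (finCongr rfl).permCongr β = β := by ext; simp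
    rw [dif_pos rfl, this]
    simp
  · rintro ⟨m, τ⟩ _ hne
    by_cases h : n = m
    · subst h
      have : (finCongr rfl).permCongr β = β := by ext; simp
      have h' : τ * β ≠ σ := by
        rintro rfl
        simp at hne
      rw [dif_pos rfl, this]
      simp [h']
    · simp [h]
  · intro h
    simp [Finsupp.notMem_support_iff.1 h]

lemma pairing_F {n : ℕ} (σ : Perm (Fin n)) (g : FQSym K) : pairing (F K σ) g = g ⟨n, σ⟩ := by
  unfold pairing F G
  rw [Finsupp.sum_single_index (by simp)]
  simp

/-- Exhibits the linearity in `f`, so that `map_sum` and `map_smul` apply. -/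
lemma specX_eq_linearCombination (t : K) (f : FQSym K) :
    specX t f = Finsupp.linearCombination K
      (fun a : Σ n : ℕ, Perm (Fin n) => evalGeom (gesselF K ℕᵒᵈ a.2⁻¹))
      (Finsupp.linearCombination K (fun a : Σ n : ℕ, Perm (Fin n) =>
        ∑ β : Perm (Fin a.1), pairing (F K a.2⁻¹) (GOneSub t β) • F K β) f) := rfl

lemma specX_F (t : K) {n : ℕ} (σ : Perm (Fin n)) :
    specX t (F K σ) =
      ∑ β : Perm (Fin n), SOneSub t n ⟨n, σ * β⁻¹⟩ • evalGeom (gesselF K ℕᵒᵈ β) := by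
  rw [specX_eq_linearCombination, F, G, Finsupp.linearCombination_single, one_smul, map_sum]
  refine Finset.sum_congr rfl fun β _ => ?_
  rw [map_smul, pairing_F, GOneSub, internalMul_G_apply, F, G, Finsupp.linearCombination_single]
  simp

lemma specX_P (t : K) (T : BinaryTree Unit) :
    specX t (P K T) =
      ∑ σ : Perm (Fin T.numNodes) with bstShape σ = T, specX t (F K σ) := by
  simp only [specX_eq_linearCombination, P, map_sum]

/-- Terms of a sequence of sum `N` are at most `N`, so the count is over a finite type; grouping its
sequences by content recovers the monomials of `gesselF`. -/
lemma coeff_evalGeom_gesselF {n : ℕ} (β : Perm (Fin n)) (N : ℕ) :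
    PowerSeries.coeff N (evalGeom (gesselF K ℕᵒᵈ β)) =
      ∑ a : Fin n → Fin (N + 1),
        if Admissible β (fun i => a i) ∧ ∑ i, (a i : ℕ) = N then 1 else 0 := by
  let content : (Fin n → Fin (N + 1)) → (ℕᵒᵈ →₀ ℕ) := fun a =>
    ∑ i, Finsupp.single (OrderDual.toDual (a i : ℕ)) 1
  let A : Finset (Fin n → Fin (N + 1)) :=
    Finset.univ.filter fun a => Admissible β (fun i => a i) ∧ ∑ i, (a i : ℕ) = N
  have weight : ∀ s : Fin n → ℕᵒᵈ,
      ((∑ i, Finsupp.single (s i) 1 : ℕᵒᵈ →₀ ℕ).sum fun i a => OrderDual.ofDual i * a) =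
        ∑ i, OrderDual.ofDual (s i) := by
    intro s
    rw [← Finsupp.sum_finsetSum_index (by simp) (by intros; simp [mul_add])]
    simp
  have key : ∀ m : ℕᵒᵈ →₀ ℕ,
      (∑ᶠ (_ : (m.sum fun i a => OrderDual.ofDual i * a) = N),
        MvPowerSeries.coeff m (gesselF K ℕᵒᵈ β)) = (({a ∈ A | content a = m}.card : ℕ) : K) := by
    intro m
    by_cases hm : (m.sum fun i a => OrderDual.ofDual i * a) = N
    · rw [finsum_eq_if, if_pos hm]
      change ((Set.ncard _ : ℕ) : K) = _
      congr 1
      rw [← Set.ncard_coe_finset]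
      symm
      refine Set.ncard_congr (fun a _ i => OrderDual.toDual (a i : ℕ)) ?_ ?_ ?_
      · intro a ha
        simp only [Finset.coe_filter, Finset.mem_filter, Finset.mem_univ, true_and, A,
          Set.mem_ofPred_eq] at ha
        exact ⟨ha.1.1.1, ha.1.1.2, ha.2⟩
      · intro a b _ _ hab
        funext i
        exact Fin.ext (congrArg OrderDual.ofDual (congrFun hab i))
      · rintro s ⟨h₁, h₂, h₃⟩
        have hs : ∑ i, OrderDual.ofDual (s i) = N := by rw [← weight, h₃, hm]
        have hlt : ∀ i, OrderDual.ofDual (s i) < N + 1 := fun i => by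
          have := Finset.single_le_sum (f := fun i => OrderDual.ofDual (s i))
            (fun _ _ => Nat.zero_le _) (Finset.mem_univ i)
          omega
        refine ⟨fun i => ⟨OrderDual.ofDual (s i), hlt i⟩, ?_, rfl⟩
        simp only [Finset.coe_filter, Finset.mem_filter, Finset.mem_univ, true_and, A,
          Set.mem_ofPred_eq]
        exact ⟨⟨⟨h₁, h₂⟩, hs⟩, h₃⟩
    · rw [finsum_eq_if, if_neg hm]
      rw [Finset.card_eq_zero.2, Nat.cast_zero]
      refine Finset.filter_eq_empty_iff.2 fun a ha h => hm ?_
      rw [← h]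
      exact (weight _).trans (Finset.mem_filter.1 ha).2.2
  rw [evalGeom, PowerSeries.coeff_mk]
  simp_rw [key]
  rw [finsum_eq_sum_of_support_subset (s := A.image content), ← Nat.cast_sum,
    ← Finset.card_eq_sum_card_fiberwise (fun a ha => Finset.mem_image_of_mem _ ha),
    Finset.card_filter]
  · push_cast
    rfl
  · intro m hm
    rw [Function.mem_support] at hm
    obtain ⟨a, ha⟩ := Finset.card_pos.1 (Nat.pos_of_ne_zero fun h => hm (by rw [h, Nat.cast_zero]))
    rw [Finset.mem_filter] at ha
    exact Finset.mem_coe.2 (Finset.mem_image.2 ⟨a, ha⟩)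

end Coordinates

/-! ### Binary search trees of sorted words -/

/-- The keys `κ o, …, κ (o + n - 1)`, placed at the nodes of `T` in infix order, form a decreasing
tree: every node carries the maximal key of its subtree. -/
def IsDecreasing {L : Type*} [LT L] : BinaryTree Unit → ℕ → (ℕ → L) → Prop
  | .nil, _, _ => True
  | .node _ l r, o, κ =>
    (∀ v, o ≤ v → v < o + (l.numNodes + r.numNodes + 1) → v ≠ o + l.numNodes →
      κ v < κ (o + l.numNodes)) ∧
    IsDecreasing l o κ ∧ IsDecreasing r (o + l.numNodes + 1) κ

/-- The last letter is inserted first and stays at the root; the others split by comparison with it,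
keeping their order. This drives the induction on `T`. -/
lemma foldr_bstInsert_concat (w : List ℕ) (y : ℕ) :
    (w ++ [y]).foldr bstInsert .nil =
      .node y ((w.filter (· ≤ y)).foldr bstInsert .nil)
        ((w.filter (y < ·)).foldr bstInsert .nil) := by
  induction w with
  | nil => simp [bstInsert]
  | cons x w ih =>
    rw [List.cons_append, List.foldr_cons, ih, bstInsert]
    by_cases h : x ≤ y
    · simp [h]
    · simp [h, not_le.1 h]

lemma numNodes_bstInsert (x : ℕ) (T : BinaryTree ℕ) :
    (bstInsert x T).numNodes = T.numNodes + 1 := by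
  induction T with
  | nil => rfl
  | node y l r hl hr =>
    rw [bstInsert]
    split_ifs <;> simp only [BinaryTree.numNodes, hl, hr] <;> omega

lemma numNodes_foldr_bstInsert (w : List ℕ) :
    (w.foldr bstInsert .nil).numNodes = w.length := by
  induction w with
  | nil => rfl
  | cons x w ih => rw [List.foldr_cons, numNodes_bstInsert, ih, List.length_cons]

lemma numNodes_map {α β : Type*} (f : α → β) (T : BinaryTree α) :
    (T.map f).numNodes = T.numNodes := by
  induction T with
  | nil => rfl
  | node y l r hl hr => simp only [BinaryTree.map, BinaryTree.numNodes, hl, hr]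

lemma length_eq_of_mem_iff {w : List ℕ} (hw : w.Nodup) {a b : ℕ}
    (h : ∀ v, v ∈ w ↔ a ≤ v ∧ v < b) : w.length = b - a := by
  rw [← List.toFinset_card_of_nodup hw, ← Nat.card_Ico]
  congr 1
  ext v
  simp [h]

/-- In a word sorted by `κ` the last letter has the largest key, and it is the root of the search
tree. Since the letters form an interval, the letter at a node is fixed by its infix position. -/
lemma map_foldr_bstInsert_eq_iff {L : Type*} [Preorder L] (κ : ℕ → L) (T : BinaryTree Unit) :
    ∀ (o : ℕ) (w : List ℕ), w.Pairwise (fun a b => κ a < κ b) →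
      (∀ v, v ∈ w ↔ o ≤ v ∧ v < o + T.numNodes) →
      ((w.foldr bstInsert .nil).map (fun _ => ()) = T ↔ IsDecreasing T o κ) := by
  induction T with
  | nil =>
    intro o w _ hmem
    have : w = [] := List.eq_nil_iff_forall_not_mem.2 fun v hv => by
      have := (hmem v).1 hv
      simp only [BinaryTree.numNodes] at this
      omega
    simp [this, IsDecreasing, BinaryTree.map]
  | node u l r hl hr =>
    intro o w hw hmem
    simp only [BinaryTree.numNodes] at hmem
    rcases List.eq_nil_or_concat w with rfl | ⟨w', y, rfl⟩
    · have := (hmem o).2 (by omega)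
      simp at this
    · rw [List.concat_eq_append] at *
      have hpair := List.pairwise_append.1 hw
      have hlt : ∀ v ∈ w', κ v < κ y := fun v hv => hpair.2.2 v hv y (by simp)
      have hy : y ∉ w' := fun h => lt_irrefl _ (hlt y h)
      have hyo := (hmem y).1 (by simp)
      have hnodup : w'.Nodup := hpair.1.imp fun {a b} h (e : a = b) => h.ne (by rw [e])
      have hmem' : ∀ v, v ∈ w' ↔ (o ≤ v ∧ v < o + (l.numNodes + r.numNodes + 1)) ∧ v ≠ y := by
        intro v
        rw [← hmem v]
        constructor
        · intro h
          exact ⟨by simp [h], fun e => hy (e ▸ h)⟩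
        · rintro ⟨h, hne⟩
          simpa [hne] using h
      have hmem₁ : ∀ v, v ∈ w'.filter (· ≤ y) ↔ o ≤ v ∧ v < y := by
        intro v
        simp only [List.mem_filter, hmem', decide_eq_true_eq]
        omega
      have hmem₂ : ∀ v, v ∈ w'.filter (y < ·) ↔
          y + 1 ≤ v ∧ v < o + (l.numNodes + r.numNodes + 1) := by
        intro v
        simp only [List.mem_filter, hmem', decide_eq_true_eq]
        omega
      rw [foldr_bstInsert_concat, BinaryTree.map, BinaryTree.node.injEq]
      have hroot : ((w'.filter (· ≤ y)).foldr bstInsert .nil).map (fun _ => ()) = l →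
          y = o + l.numNodes := by
        intro h
        have := congrArg BinaryTree.numNodes h
        rw [numNodes_map, numNodes_foldr_bstInsert,
          length_eq_of_mem_iff (hnodup.filter _) hmem₁] at this
        omega
      -- Otherwise the last letter `y` and the infix root would each have a key strictly larger than
      -- the other.
      have hroot' : IsDecreasing (.node u l r) o κ → y = o + l.numNodes := by
        rintro ⟨h, -⟩
        by_contra hne
        have h₁ := h y hyo.1 hyo.2 hne
        have h₂ := hlt (o + l.numNodes) ((hmem' _).2 ⟨by omega, Ne.symm hne⟩)
        exact lt_irrefl _ (h₁.trans h₂)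
      have main : y = o + l.numNodes →
          ((() = u ∧ ((w'.filter (· ≤ y)).foldr bstInsert .nil).map (fun _ => ()) = l ∧
            ((w'.filter (y < ·)).foldr bstInsert .nil).map (fun _ => ()) = r) ↔
          IsDecreasing (.node u l r) o κ) := by
        intro e
        rw [hl o _ (hpair.1.filter _) (by intro v; rw [hmem₁, e]),
          hr (o + l.numNodes + 1) _ (hpair.1.filter _)
            (by intro v; rw [hmem₂, e]; omega), IsDecreasing]
        have : ∀ v, o ≤ v → v < o + (l.numNodes + r.numNodes + 1) → v ≠ o + l.numNodes →
            κ v < κ (o + l.numNodes) := by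
          intro v h₁ h₂ h₃
          rw [← e] at h₃ ⊢
          exact hlt v ((hmem' v).2 ⟨⟨h₁, h₂⟩, h₃⟩)
        tauto
      constructor
      · intro h
        exact (main (hroot h.2.1)).1 h
      · intro h
        exact (main (hroot' h)).2 h

lemma bstShape_eq_iff {L : Type*} [Preorder L] (κ : ℕ → L) (T : BinaryTree Unit)
    (σ : Perm (Fin T.numNodes)) (h : StrictMono fun i => κ (σ i)) :
    bstShape σ = T ↔ IsDecreasing T 0 κ := by
  refine map_foldr_bstInsert_eq_iff κ T 0 _ ?_ ?_
  · rw [List.pairwise_ofFn]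
    exact fun i j hij => h hij
  · intro v
    rw [List.mem_ofFn]
    constructor
    · rintro ⟨i, rfl⟩
      simp
    · intro hv
      exact ⟨σ.symm ⟨v, by omega⟩, by simp⟩

/-! ### Signed labels and sorting -/

/-- The label of the letter `v`, barred or not: barred letters are smaller than the others and in
the reversed order. -/
def signedLabel (v : ℕ) (b : Bool) : ℤ := if b then -(v + 1 : ℤ) else v

/-- The key by which the letters are sorted: larger values first, then smaller signed labels. -/
def key (v : ℕ) (x : ℕ × Bool) : ℕᵒᵈ ×ₗ ℤ :=
  toLex (OrderDual.toDual x.1, signedLabel v x.2)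

lemma signedLabel_lt_iff_of_lt {u v : ℕ} (h : u < v) (a b : Bool) :
    signedLabel u a < signedLabel v b ↔ b = false := by
  cases a <;> cases b <;> simp [signedLabel] <;> omega

lemma signedLabel_lt_iff_of_gt {u v : ℕ} (h : v < u) (a b : Bool) :
    signedLabel u a < signedLabel v b ↔ a = true := by
  cases a <;> cases b <;> simp [signedLabel] <;> omega

lemma eq_of_signedLabel_eq {u v : ℕ} {a b : Bool} (h : signedLabel u a = signedLabel v b) :
    u = v := by
  cases a <;> cases b <;> simp [signedLabel] at h <;> omega

lemma key_lt_key {u v : ℕ} {x y : ℕ × Bool} :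
    key u x < key v y ↔ y.1 < x.1 ∨ x.1 = y.1 ∧ signedLabel u x.2 < signedLabel v y.2 := by
  simp [key, Prod.Lex.toLex_lt_toLex]

lemma eq_of_key_eq {u v : ℕ} {x y : ℕ × Bool} (h : key u x = key v y) : u = v := by
  refine eq_of_signedLabel_eq (a := x.2) (b := y.2) ?_
  exact congrArg (fun z => (ofLex z).2) h

lemma existsUnique_strictMono_comp {L : Type*} [LinearOrder L] {n : ℕ} {κ : Fin n → L}
    (hκ : Function.Injective κ) : ∃! σ : Perm (Fin n), StrictMono fun i => κ (σ i) := by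
  refine ⟨Tuple.sort κ, (Tuple.monotone_sort κ).strictMono_of_injective
    (hκ.comp (Tuple.sort κ).injective), fun σ hσ => ?_⟩
  have := Tuple.unique_monotone (StrictMono.monotone hσ) (Tuple.monotone_sort κ)
  exact Equiv.ext fun i => hκ (congrFun this i)

/-- Exactly one permutation sorts injective keys, so the sum has a single surviving term. It is used
to eliminate first `β`, then `σ`. -/
lemma sum_strictMono_comp {R L : Type*} [AddCommMonoid R] [LinearOrder L] {n : ℕ} {κ : Fin n → L}
    (hκ : Function.Injective κ) (p : Perm (Fin n) → Prop) (c : Prop) [Decidable c]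
    [∀ σ : Perm (Fin n), Decidable (p σ ∧ StrictMono fun i => κ (σ i))] (x : R)
    (h : ∀ σ : Perm (Fin n), (StrictMono fun i => κ (σ i)) → (p σ ↔ c)) :
    (∑ σ : Perm (Fin n), if p σ ∧ StrictMono (fun i => κ (σ i)) then x else 0) =
      if c then x else 0 := by
  obtain ⟨σ, hσ, huniq⟩ := existsUnique_strictMono_comp hκ
  rw [Finset.sum_eq_single σ]
  · exact if_congr (by simp only [h σ hσ, hσ, and_true]) rfl rfl
  · intro τ _ hne
    rw [if_neg]
    exact fun h' => hne (huniq τ h'.2)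
  · simp

/-- The weight of a letter, barred or not. -/
def signWeight {R : Type*} [CommRing R] (t : R) (b : Bool) : R := if b then -t else 1

lemma strictMono_signedLabel_iff {n : ℕ} (τ : Perm (Fin n)) (η : Fin n → Bool) :
    StrictMono (fun i => signedLabel (τ i) (η i)) ↔
      ∀ i j, i < j → (η j = true → η i = true) ∧ (η j = true → τ j < τ i) ∧
        (η i = false → τ i < τ j) := by
  refine forall₂_congr fun i j => forall_congr' fun hij => ?_
  simp only
  rcases lt_trichotomy (τ i) (τ j) with h | h | h
  · rw [signedLabel_lt_iff_of_lt h]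
    cases η i <;> cases η j <;> simp [h, h.le]
  · exact absurd (τ.injective h) hij.ne
  · rw [signedLabel_lt_iff_of_gt h]
    cases η i <;> cases η j <;> simp [h, h.le]

lemma strictMono_signedLabel_decide_iff {n : ℕ} (τ : Perm (Fin n)) (k : ℕ) :
    StrictMono (fun i : Fin n => signedLabel (τ i) (decide ((i : ℕ) < k))) ↔ IsValley k τ := by
  rw [strictMono_signedLabel_iff]
  refine forall₂_congr fun i j => forall_congr' fun hij => ?_
  have hij' : (i : ℕ) < j := hij
  simp only [decide_eq_true_eq, decide_eq_false_iff_not, not_lt]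
  constructor
  · exact fun h => h.2
  · exact fun h => ⟨fun h' => hij'.trans h', h⟩

lemma exists_eq_decide_lt {n : ℕ} (η : Fin n → Bool)
    (h : ∀ i j, i < j → η j = true → η i = true) :
    ∃ k < n + 1, η = fun i : Fin n => decide ((i : ℕ) < k) := by
  have hex : ∃ k, ∀ hk : k < n, η ⟨k, hk⟩ = false := ⟨n, fun hk => absurd hk (lt_irrefl n)⟩
  refine ⟨Nat.find hex, Nat.lt_succ_of_le (Nat.find_min' hex fun hk => absurd hk (lt_irrefl n)), ?_⟩
  funext i
  by_cases hi : (i : ℕ) < Nat.find hex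
  · have := Nat.find_min hex hi
    push Not at this
    obtain ⟨_, hi'⟩ := this
    simpa [hi] using hi'
  · rw [decide_eq_false hi]
    rw [not_lt] at hi
    by_contra hη
    rw [Bool.not_eq_false] at hη
    have hk : Nat.find hex < n := hi.trans_lt i.2
    have hspec := Nat.find_spec hex hk
    rcases hi.lt_or_eq with hlt | heq
    · rw [h ⟨Nat.find hex, hk⟩ i hlt hη] at hspec
      cases hspec
    · have : (⟨Nat.find hex, hk⟩ : Fin n) = i := Fin.ext heq
      rw [this, hη] at hspec
      cases hspec

lemma prod_signWeight_decide {R : Type*} [CommRing R] (t : R) {n k : ℕ} (hk : k ≤ n) :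
    ∏ i : Fin n, signWeight t (decide ((i : ℕ) < k)) = (-t) ^ k := by
  rw [Fin.prod_univ_eq_prod_range (fun i => signWeight t (decide (i < k))) n,
    ← Finset.prod_range_mul_prod_Ico _ hk]
  rw [Finset.prod_congr rfl (g := fun _ => -t), Finset.prod_congr (s₁ := Finset.Ico k n) rfl
    (g := fun _ => (1 : R))]
  · simp
  · intro i hi
    simp [signWeight, (Finset.mem_Ico.1 hi).1]
  · intro i hi
    simp [signWeight, Finset.mem_range.1 hi]

/-- In a word sorted by signed labels the barred letters form an initial segment, so a barring is
the same as a cut position `k`, and its weight is `(-t)^k`. -/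
lemma sum_isValley {R : Type*} [CommRing R] (t : R) {n : ℕ} (τ : Perm (Fin n)) :
    (∑ k ∈ Finset.range (n + 1), if IsValley k τ then (-t) ^ k else 0) =
      ∑ ε : Fin n → Bool, if StrictMono (fun i => signedLabel (τ i) (ε (τ i))) then
        ∏ v, signWeight t (ε v) else 0 := by
  have reindex : (∑ ε : Fin n → Bool, if StrictMono (fun i => signedLabel (τ i) (ε (τ i))) then
        ∏ v, signWeight t (ε v) else 0) =
      ∑ η : Fin n → Bool, if StrictMono (fun i => signedLabel (τ i) (η i)) then
        ∏ v, signWeight t (η v) else 0 := by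
    -- Bars are moved from letters to positions: `η = ε ∘ τ`.
    refine Fintype.sum_equiv (Equiv.arrowCongr τ⁻¹ (Equiv.refl Bool)) _ _ fun ε => ?_
    have : ∏ v, signWeight t (ε v) = ∏ v, signWeight t (ε (τ v)) :=
      (Equiv.prod_comp τ fun v => signWeight t (ε v)).symm
    rw [this]
    rfl
  rw [reindex]
  refine Finset.sum_of_injOn (fun k i => decide ((i : ℕ) < k)) ?_ (by simp [Set.MapsTo]) ?_ ?_
  · intro a ha b hb hab
    simp only [Finset.coe_range, Set.mem_Iio] at ha hb
    by_contra hne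
    rcases lt_or_gt_of_ne hne with h | h
    · have := congrFun hab ⟨a, by omega⟩
      simp only [decide_eq_decide] at this
      omega
    · have := congrFun hab ⟨b, by omega⟩
      simp only [decide_eq_decide] at this
      omega
  · intro η _ hη
    rw [if_neg]
    intro h
    rw [strictMono_signedLabel_iff] at h
    obtain ⟨k, hk, rfl⟩ := exists_eq_decide_lt η fun i j hij => (h i j hij).1
    exact hη ⟨k, by simpa using hk, rfl⟩
  · intro k hk
    rw [prod_signWeight_decide t (by simpa [Nat.lt_succ_iff] using hk)]
    simp only [strictMono_signedLabel_decide_iff]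

/-! ### The specialization as a sum over labelled trees -/

section Coefficients

variable {K : Type*} [CommRing K]

/-- By `h`, `β` orders positions as the signed labels do, so a strict drop of `a` is forced exactly
where these labels descend: ties in value are broken by the labels, as in `key`. -/
lemma admissible_iff_strictMono {n : ℕ} (β : Perm (Fin n)) (a : Fin n → ℕ) (σ : Perm (Fin n))
    (ε : Fin n → Bool)
    (h : ∀ i j, signedLabel (σ i) (ε (σ i)) < signedLabel (σ j) (ε (σ j)) ↔ β i < β j) :
    Admissible β a ↔ StrictMono fun i => key (σ i) (a i, ε (σ i)) := by
  constructor
  · rintro ⟨hanti, hdesc⟩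
    rcases n with _ | n
    · exact fun i => i.elim0
    · refine Fin.strictMono_iff_lt_succ.2 fun i => ?_
      rw [key_lt_key]
      have hle : a i.succ ≤ a i.castSucc := hanti i.castSucc_lt_succ.le
      rcases lt_trichotomy (β i.castSucc) (β i.succ) with hβ | hβ | hβ
      · rcases hle.lt_or_eq with hlt | heq
        · exact Or.inl hlt
        · exact Or.inr ⟨heq.symm, (h _ _).2 hβ⟩
      · exact absurd (β.injective hβ) i.castSucc_lt_succ.ne
      · exact Or.inl (hdesc _ _ (by simp) hβ)
  · intro hmono
    constructor
    · intro i j hij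
      rcases hij.lt_or_eq with hlt | rfl
      · rcases key_lt_key.1 (hmono hlt) with h' | h'
        · exact h'.le
        · exact h'.1.ge
      · exact le_rfl
    · intro i j hij hβ
      have hlt : i < j := Fin.lt_def.2 (by omega)
      rcases key_lt_key.1 (hmono hlt) with h' | h'
      · exact h'
      · exact absurd ((h i j).1 h'.2) hβ.not_gt

lemma coeff_specX_F (t : K) {n : ℕ} (σ : Perm (Fin n)) (N : ℕ) :
    PowerSeries.coeff N (specX t (F K σ)) =
      ∑ ε : Fin n → Bool, ∑ f : Fin n → Fin (N + 1),
        if (StrictMono fun i => key (σ i) (f (σ i), ε (σ i))) ∧ ∑ v, (f v : ℕ) = N then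
          ∏ v, signWeight t (ε v) else 0 := by
  have inner : ∀ (ε : Fin n → Bool) (a : Fin n → Fin (N + 1)),
      (∑ β : Perm (Fin n),
        if (Admissible β (fun i => a i) ∧ ∑ v, (a v : ℕ) = N) ∧
          StrictMono (fun i => signedLabel ((σ * β⁻¹) i) (ε ((σ * β⁻¹) i))) then
          ∏ v, signWeight t (ε v) else 0) =
      if (StrictMono fun i => key (σ i) (a i, ε (σ i))) ∧ ∑ v, (a v : ℕ) = N then
        ∏ v, signWeight t (ε v) else 0 := by
    intro ε a
    -- After inversion, `β` runs over the permutations sorting the signed labels of the word `σ`,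
    -- and only one does.
    rw [← Equiv.sum_comp (Equiv.inv (Perm (Fin n)))]
    simp only [Equiv.inv_apply, inv_inv]
    refine sum_strictMono_comp (R := K) (κ := fun i => signedLabel (σ i) (ε (σ i)))
      (fun i j hij => σ.injective (Fin.ext (eq_of_signedLabel_eq hij)))
      (fun β => Admissible β⁻¹ (fun i => a i) ∧ ∑ v, (a v : ℕ) = N) _ _ fun β hβ => ?_
    refine and_congr_left fun _ => admissible_iff_strictMono _ _ _ _ fun i j => ?_
    simpa using hβ.lt_iff_lt (a := β⁻¹ i) (b := β⁻¹ j)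
  rw [specX_F, map_sum]
  simp_rw [map_smul, SOneSub_apply, sum_isValley, coeff_evalGeom_gesselF, smul_eq_mul,
    Finset.sum_mul_sum]
  rw [Finset.sum_comm]
  refine Finset.sum_congr rfl fun ε _ => ?_
  rw [Finset.sum_comm]
  -- Values are moved from positions to letters: `a = f ∘ σ`.
  refine Fintype.sum_equiv (Equiv.arrowCongr σ (Equiv.refl (Fin (N + 1)))) _ _ fun a => ?_
  have hsum : ∑ v, ((Equiv.arrowCongr σ (Equiv.refl (Fin (N + 1))) a v : Fin (N + 1)) : ℕ) =
      ∑ v, (a v : ℕ) := by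
    rw [← Equiv.sum_comp σ]
    simp
  rw [hsum]
  simp only [Equiv.arrowCongr_apply, Function.comp_apply, Equiv.symm_apply_apply,
    Equiv.coe_refl, id]
  rw [← inner]
  refine Finset.sum_congr rfl fun β _ => ?_
  rw [ite_mul, zero_mul, mul_ite, mul_one, mul_zero, ← ite_and]
  exact if_congr (and_comm) rfl rfl

/-- A finite word extended to all positions. -/
def extend {n : ℕ} (w : Fin n → ℕ × Bool) (v : ℕ) : ℕ × Bool :=
  if h : v < n then w ⟨v, h⟩ else (0, false)

lemma coeff_specX_P (t : K) (T : BinaryTree Unit) (N : ℕ) :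
    PowerSeries.coeff N (specX t (P K T)) =
      ∑ ε : Fin T.numNodes → Bool, ∑ f : Fin T.numNodes → Fin (N + 1),
        if IsDecreasing T 0 (fun v => key v (extend (fun i => (f i, ε i)) v)) ∧
          ∑ v, (f v : ℕ) = N then ∏ v, signWeight t (ε v) else 0 := by
  rw [specX_P, map_sum]
  simp_rw [coeff_specX_F]
  rw [Finset.sum_comm]
  refine Finset.sum_congr rfl fun ε _ => ?_
  rw [Finset.sum_comm]
  refine Finset.sum_congr rfl fun f _ => ?_
  rw [Finset.sum_filter]
  simp_rw [← ite_and]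
  have := sum_strictMono_comp (κ := fun v => key v (f v, ε v))
    (fun i j hij => Fin.ext (eq_of_key_eq hij))
    (fun σ => bstShape σ = T ∧ ∑ v, (f v : ℕ) = N)
    (IsDecreasing T 0 (fun v => key v (extend (fun i => (f i, ε i)) v)) ∧ ∑ v, (f v : ℕ) = N)
    (∏ v, signWeight t (ε v)) fun σ hσ => by
      refine and_congr_left fun _ => bstShape_eq_iff _ T σ ?_
      simpa [extend] using hσ
  rw [← this]
  refine Finset.sum_congr rfl fun σ _ => if_congr (by tauto) rfl rfl

end Coefficients

/-! ### Sums over words -/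

/-- The labels `w` (values and bars), placed at the nodes of the tree in infix order, are
compatible: a left son is at least its father, strictly if the father is barred, and a right son is
at least its father, strictly if the son is not barred. The root is at least `b` if it is barred and
at least `a` otherwise. -/
def IsCompatible : BinaryTree Unit → ℕ → ℕ → List (ℕ × Bool) → Prop
  | .nil, _, _, _ => True
  | .node _ l r, a, b, w =>
    let x := w.getD l.numNodes (0, false)
    (if x.2 then b else a) ≤ x.1 ∧
      IsCompatible l (x.1 + if x.2 then 1 else 0) (x.1 + if x.2 then 1 else 0)
        (w.take l.numNodes) ∧
      IsCompatible r (x.1 + 1) x.1 (w.drop (l.numNodes + 1))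

/-- At equal values the bar of the larger letter decides. A left descendant is thus bounded through
its ancestor's bar, a right descendant through its own. -/
lemma key_lt_key_iff_of_lt {u v : ℕ} (h : u < v) (x y : ℕ × Bool) :
    key u x < key v y ↔ (y.1 + if y.2 then 1 else 0) ≤ x.1 := by
  rw [key_lt_key, signedLabel_lt_iff_of_lt h]
  rcases y with ⟨j, _ | _⟩
  · simp
    omega
  · simp

lemma key_lt_key_iff_of_gt {u v : ℕ} (h : v < u) (x y : ℕ × Bool) :
    key u x < key v y ↔ (if x.2 then y.1 else y.1 + 1) ≤ x.1 := by
  rw [key_lt_key, signedLabel_lt_iff_of_gt h]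
  rcases x with ⟨j, _ | _⟩
  · simp
  · simp
    omega

/-- The predicate `p` stands for "below the father". It is inherited by smaller keys, so checking it
at the root, which carries the maximal key, settles it on the whole subtree. -/
lemma isCompatible_iff (f : ℕ → ℕ × Bool) (T : BinaryTree Unit) :
    ∀ (o a b : ℕ) (p : ℕ → Prop),
      (∀ u v, key u (f u) < key v (f v) → p v → p u) →
      (∀ v, o ≤ v → v < o + T.numNodes → (p v ↔ (if (f v).2 then b else a) ≤ (f v).1)) →
      (IsCompatible T a b ((List.range' o T.numNodes).map f) ↔
        IsDecreasing T o (fun v => key v (f v)) ∧ ∀ v, o ≤ v → v < o + T.numNodes → p v) := by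
  induction T with
  | nil =>
    intro o a b p _ _
    simp only [IsCompatible, IsDecreasing, BinaryTree.numNodes, true_and, true_iff]
    omega
  | node u l r hl hr =>
    intro o a b p hdown hp
    simp only [BinaryTree.numNodes] at hp
    have hget : ((List.range' o (l.numNodes + r.numNodes + 1)).map f).getD l.numNodes (0, false) =
        f (o + l.numNodes) := by
      rw [List.getD_eq_getElem _ _ (by simp)]
      simp
    have htake : ((List.range' o (l.numNodes + r.numNodes + 1)).map f).take l.numNodes =
        (List.range' o l.numNodes).map f := by
      rw [add_assoc, ← List.range'_append_1, List.map_append, List.take_left' (by simp)]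
    have hdrop : ((List.range' o (l.numNodes + r.numNodes + 1)).map f).drop (l.numNodes + 1) =
        (List.range' (o + l.numNodes + 1) r.numNodes).map f := by
      rw [← List.map_drop, List.drop_range']
      congr 2 <;> omega
    simp only [IsCompatible, BinaryTree.numNodes, hget, htake, hdrop]
    rw [← hp (o + l.numNodes) (by omega) (by omega),
      hl o _ _ (fun v => key v (f v) < key (o + l.numNodes) (f (o + l.numNodes)))
        (fun _ _ h h' => h.trans h')
        (fun v _ h => by rw [key_lt_key_iff_of_lt h]; simp),
      hr (o + l.numNodes + 1) _ _
        (fun v => key v (f v) < key (o + l.numNodes) (f (o + l.numNodes)))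
        (fun _ _ h h' => h.trans h')
        (fun v h _ => by rw [key_lt_key_iff_of_gt (by omega)])]
    simp only [IsDecreasing]
    constructor
    · rintro ⟨h₁, ⟨h₂, h₃⟩, h₄, h₅⟩
      have hmax : ∀ v, o ≤ v → v < o + (l.numNodes + r.numNodes + 1) → v ≠ o + l.numNodes →
          key v (f v) < key (o + l.numNodes) (f (o + l.numNodes)) := by
        intro v hv hv' hne
        rcases lt_or_gt_of_ne hne with h | h
        · exact h₃ v hv h
        · exact h₅ v (by omega) (by omega)
      refine ⟨⟨hmax, h₂, h₄⟩, fun v hv hv' => ?_⟩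
      by_cases hne : v = o + l.numNodes
      · rwa [hne]
      · exact hdown _ _ (hmax v hv hv' hne) h₁
    · rintro ⟨⟨h₁, h₂, h₃⟩, h₄⟩
      exact ⟨h₄ _ (by omega) (by omega), ⟨h₂, fun v hv hv' => h₁ v hv (by omega) (by omega)⟩, h₃,
        fun v hv hv' => h₁ v (by omega) (by omega) (by omega)⟩

section WordSum

variable {R : Type*} [CommRing R]

/-- The sum of `g w`, weighted by the product of the weights `c` of the letters, over the words `w`
of a given length with values less than `m`. -/
def wordSum (m : ℕ) (c : ℕ × Bool → R) : ℕ → (List (ℕ × Bool) → R) → R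
  | 0, g => g []
  | n + 1, g => ∑ x : Fin m × Bool, c (x.1, x.2) * wordSum m c n fun w => g ((↑x.1, x.2) :: w)

lemma wordSum_eq_sum (m : ℕ) (c : ℕ × Bool → R) (n : ℕ) (g : List (ℕ × Bool) → R) :
    wordSum m c n g = ∑ w : Fin n → Fin m × Bool,
      (∏ i, c ((w i).1, (w i).2)) * g (List.ofFn fun i => (((w i).1 : ℕ), (w i).2)) := by
  induction n generalizing g with
  | zero => simp [wordSum]
  | succ n ih =>
    rw [← Equiv.sum_comp (Fin.consEquiv fun _ => Fin m × Bool), Fintype.sum_prod_type, wordSum]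
    refine Finset.sum_congr rfl fun x _ => ?_
    rw [ih, Finset.mul_sum]
    refine Finset.sum_congr rfl fun w _ => ?_
    simp [Fin.prod_univ_succ, List.ofFn_succ, Fin.consEquiv, mul_assoc]

lemma wordSum_congr (m : ℕ) (c : ℕ × Bool → R) {n : ℕ} {g h : List (ℕ × Bool) → R}
    (H : ∀ w, w.length = n → g w = h w) : wordSum m c n g = wordSum m c n h := by
  rw [wordSum_eq_sum, wordSum_eq_sum]
  exact Finset.sum_congr rfl fun w _ => by rw [H _ (by simp)]

lemma wordSum_mul_left (m : ℕ) (c : ℕ × Bool → R) (n : ℕ) (x : R) (g : List (ℕ × Bool) → R) :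
    wordSum m c n (fun w => x * g w) = x * wordSum m c n g := by
  rw [wordSum_eq_sum, wordSum_eq_sum, Finset.mul_sum]
  exact Finset.sum_congr rfl fun w _ => by ring

lemma wordSum_sum {ι : Type*} (s : Finset ι) (m : ℕ) (c : ℕ × Bool → R) (n : ℕ)
    (g : ι → List (ℕ × Bool) → R) :
    wordSum m c n (fun w => ∑ i ∈ s, g i w) = ∑ i ∈ s, wordSum m c n (g i) := by
  simp_rw [wordSum_eq_sum, Finset.mul_sum]
  exact Finset.sum_comm

lemma wordSum_add (m : ℕ) (c : ℕ × Bool → R) (k l : ℕ) (g : List (ℕ × Bool) → R) :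
    wordSum m c (k + l) g = wordSum m c k fun u => wordSum m c l fun v => g (u ++ v) := by
  induction k generalizing g with
  | zero => simp [wordSum]
  | succ k ih =>
    rw [Nat.succ_add, wordSum, wordSum]
    exact Finset.sum_congr rfl fun x _ => by rw [ih]; rfl

/-- The weighted sum over the compatible labellings of a tree with values less than `m`. -/
noncomputable def treeSum (m : ℕ) (c : ℕ × Bool → R) (T : BinaryTree Unit) (a b : ℕ) : R :=
  wordSum m c T.numNodes fun w => if IsCompatible T a b w then 1 else 0

lemma treeSum_nil (m : ℕ) (c : ℕ × Bool → R) (a b : ℕ) : treeSum m c .nil a b = 1 := by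
  simp [treeSum, wordSum, IsCompatible, BinaryTree.numNodes]

lemma treeSum_node (m : ℕ) (c : ℕ × Bool → R) (u : Unit) (l r : BinaryTree Unit) (a b : ℕ) :
    treeSum m c (.node u l r) a b = ∑ x : Fin m × Bool,
      c (x.1, x.2) * if (if x.2 then b else a) ≤ (x.1 : ℕ) then
        treeSum m c l (x.1 + if x.2 then 1 else 0) (x.1 + if x.2 then 1 else 0) *
          treeSum m c r (x.1 + 1) x.1 else 0 := by
  rw [treeSum, BinaryTree.numNodes, add_assoc, wordSum_add]
  simp_rw [wordSum]
  rw [wordSum_sum]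
  refine Finset.sum_congr rfl fun x _ => ?_
  rw [wordSum_mul_left]
  congr 1
  have : ∀ p : List (ℕ × Bool), p.length = l.numNodes →
      (wordSum m c r.numNodes fun w =>
        if IsCompatible (.node u l r) a b (p ++ (↑x.1, x.2) :: w) then (1 : R) else 0) =
      (if (if x.2 then b else a) ≤ (x.1 : ℕ) then treeSum m c r (x.1 + 1) x.1 else 0) *
        if IsCompatible l (x.1 + if x.2 then 1 else 0) (x.1 + if x.2 then 1 else 0) p then
          (1 : R) else 0 := by
    intro p hp
    have hcompat : ∀ w, IsCompatible (.node u l r) a b (p ++ (↑x.1, x.2) :: w) ↔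
        (if x.2 then b else a) ≤ (x.1 : ℕ) ∧
        IsCompatible l (x.1 + if x.2 then 1 else 0) (x.1 + if x.2 then 1 else 0) p ∧
        IsCompatible r (x.1 + 1) x.1 w := by
      intro w
      simp only [IsCompatible]
      rw [← hp, List.take_left, List.getD_append_right _ _ _ _ le_rfl, ← List.drop_drop,
        List.drop_left]
      simp
    simp_rw [hcompat]
    by_cases h₁ : (if x.2 then b else a) ≤ (x.1 : ℕ)
    · by_cases h₂ : IsCompatible l (x.1 + if x.2 then 1 else 0) (x.1 + if x.2 then 1 else 0) p
      · simp [h₁, h₂, treeSum]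
      · simp [h₂, wordSum_eq_sum]
    · simp [h₁, wordSum_eq_sum]
  rw [wordSum_congr m c this, wordSum_mul_left, ← treeSum]
  split_ifs <;> ring

end WordSum

/-! ### The generating series of the labelled trees -/

section Series

open PowerSeries

variable {K : Type*} [Field K]

/-- The weight of a labelled node. -/
noncomputable def letterWeight (t : K) (x : ℕ × Bool) : PowerSeries K :=
  X ^ x.1 * signWeight (C t) x.2

/-- The generating series of the labellings of `T` whose root is at least `b` if it is barred and
at least `a` otherwise, in terms of the generating series `A` of those with root not barred. -/
noncomputable def thresholdSeries (t : K) (A : PowerSeries K) (T : BinaryTree Unit) (a b : ℕ) :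
    PowerSeries K :=
  if T = .nil then 1 else
    (X ^ (a * T.numNodes) - C t * X ^ (b * T.numNodes + T.left.numNodes)) * A

/-- The generating series of the compatible labellings of `T` with root not barred. -/
noncomputable def unbarredSeries (t : K) : BinaryTree Unit → PowerSeries K
  | .nil => 1
  | .node _ l r => (1 - X ^ (l.numNodes + r.numNodes + 1))⁻¹ *
      (thresholdSeries t (unbarredSeries t l) l 0 0 * thresholdSeries t (unbarredSeries t r) r 1 0)

/-- Series counterpart of adding `k` to every value. -/
lemma thresholdSeries_add (t : K) (A : PowerSeries K) (T : BinaryTree Unit) (a b k : ℕ) :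
    thresholdSeries t A T (k + a) (k + b) = X ^ (k * T.numNodes) * thresholdSeries t A T a b := by
  unfold thresholdSeries
  split_ifs with h
  · simp [h, BinaryTree.numNodes]
  · ring

lemma one_sub_X_pow_mul_inv {n : ℕ} (hn : n ≠ 0) :
    (1 - X ^ n : PowerSeries K) * (1 - X ^ n)⁻¹ = 1 :=
  PowerSeries.mul_inv_cancel _ (by simp [hn])

lemma one_sub_X_pow_mul_sum (n a m : ℕ) :
    (1 - X ^ n : PowerSeries K) * ∑ j ∈ Finset.range m, (if a ≤ j then X ^ (j * n) else 0) =
      X ^ (a * n) - X ^ (max a m * n) := by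
  induction m with
  | zero => simp
  | succ m ih =>
    rw [Finset.sum_range_succ, mul_add, ih]
    by_cases h : a ≤ m
    · rw [if_pos h, max_eq_right h, max_eq_right (by omega)]
      ring
    · rw [if_neg h, max_eq_left (by omega), max_eq_left (by omega)]
      ring

lemma X_pow_dvd_sum_sub {n : ℕ} (hn : n ≠ 0) (a m : ℕ) :
    (X ^ m : PowerSeries K) ∣ (∑ j ∈ Finset.range m, if a ≤ j then X ^ (j * n) else 0) -
      X ^ (a * n) * (1 - X ^ n)⁻¹ := by
  have h := one_sub_X_pow_mul_inv (K := K) hn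
  have h' := one_sub_X_pow_mul_sum (K := K) n a m
  have : (∑ j ∈ Finset.range m, if a ≤ j then X ^ (j * n) else 0) -
      X ^ (a * n) * (1 - X ^ n)⁻¹ = X ^ (max a m * n) * -(1 - X ^ n : PowerSeries K)⁻¹ := by
    linear_combination (1 - X ^ n : PowerSeries K)⁻¹ * h' -
      (∑ j ∈ Finset.range m, if a ≤ j then (X : PowerSeries K) ^ (j * n) else 0) * h
  rw [this]
  refine Dvd.dvd.mul_right (pow_dvd_pow _ ?_) _
  exact (le_max_right a m).trans (Nat.le_mul_of_pos_right _ (Nat.pos_of_ne_zero hn))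

/-- Bounding the values by `m` keeps the sums finite and costs only multiples of `X ^ m`. Modulo `X
^ m`, the sum over root values is a full geometric series. -/
lemma X_pow_dvd_treeSum_sub (t : K) (m : ℕ) (T : BinaryTree Unit) :
    ∀ a b, X ^ m ∣ treeSum m (letterWeight t) T a b -
      thresholdSeries t (unbarredSeries t T) T a b := by
  set I : Ideal (PowerSeries K) := Ideal.span {X ^ m}
  have hI : ∀ x y, X ^ m ∣ x - y ↔ Ideal.Quotient.mk I x = Ideal.Quotient.mk I y := fun x y => by
    rw [Ideal.Quotient.eq, Ideal.mem_span_singleton]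
  simp_rw [hI]
  induction T with
  | nil => intro a b; simp [treeSum_nil, thresholdSeries]
  | node u l r hl hr =>
    intro a b
    obtain ⟨D, hD⟩ : ∃ D, D = thresholdSeries t (unbarredSeries t l) l 0 0 *
      thresholdSeries t (unbarredSeries t r) r 1 0 := ⟨_, rfl⟩
    set n := l.numNodes + r.numNodes + 1 with hn
    -- Here `j` is the value of the root and `k` is `1` if it is barred, `0` otherwise. The factor
    -- `D` depends on neither.
    have hterm : ∀ (j k : ℕ), Ideal.Quotient.mk I (treeSum m (letterWeight t) l (j + k) (j + k) *
        treeSum m (letterWeight t) r (j + 1) j) =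
        Ideal.Quotient.mk I (X ^ (j * (l.numNodes + r.numNodes)) * X ^ (k * l.numNodes) * D) := by
      intro j k
      rw [map_mul, hl, hr, ← map_mul, hD]
      have h₁ := thresholdSeries_add t (unbarredSeries t l) l 0 0 (j + k)
      have h₂ := thresholdSeries_add t (unbarredSeries t r) r 1 0 j
      simp only [add_zero] at h₁ h₂
      rw [h₁, h₂]
      congr 1
      ring
    have hsum : ∀ a, Ideal.Quotient.mk I
        (∑ j ∈ Finset.range m, if a ≤ j then X ^ (j * n) else 0) =
        Ideal.Quotient.mk I (X ^ (a * n) * (1 - X ^ n)⁻¹) := fun a =>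
      (hI _ _).1 (X_pow_dvd_sum_sub (by omega) a m)
    have hsplit : Ideal.Quotient.mk I (treeSum m (letterWeight t) (.node u l r) a b) =
        Ideal.Quotient.mk I
          ((∑ j ∈ Finset.range m, if a ≤ j then X ^ (j * n) else 0) * D -
            C t * X ^ l.numNodes *
              (∑ j ∈ Finset.range m, if b ≤ j then X ^ (j * n) else 0) * D) := by
      rw [treeSum_node, Fintype.sum_prod_type, Finset.sum_mul, Finset.mul_sum, Finset.sum_mul,
        ← Finset.sum_sub_distrib, ← Fin.sum_univ_eq_sum_range (fun j =>
          (if a ≤ j then X ^ (j * n) else 0) * D -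
            C t * X ^ l.numNodes * (if b ≤ j then X ^ (j * n) else 0) * D), map_sum, map_sum]
      refine Finset.sum_congr rfl fun j _ => ?_
      rw [Fintype.sum_bool, map_add, map_sub, add_comm, sub_eq_add_neg]
      have e₀ := hterm j 0
      have e₁ := hterm j 1
      simp only [add_zero] at e₀
      congr 1
      · by_cases h : a ≤ (j : ℕ)
        · simp only [Bool.false_eq_true, if_false, h, if_true, add_zero]
          rw [map_mul, e₀, ← map_mul, letterWeight, signWeight]
          congr 1
          simp only [Bool.false_eq_true, if_false, hn]
          ring
        · simp [h]
      · by_cases h : b ≤ (j : ℕ)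
        · simp only [h, if_true]
          rw [map_mul, e₁, ← map_mul, ← map_neg, letterWeight, signWeight]
          congr 1
          simp only [if_true, hn]
          ring
        · simp [h]
    rw [hsplit, map_sub, map_mul, map_mul, map_mul, hsum, hsum, ← map_mul, ← map_mul, ← map_mul,
      ← map_sub, thresholdSeries, if_neg (by simp), unbarredSeries]
    simp only [BinaryTree.numNodes, BinaryTree.left]
    rw [← hD, ← hn]
    congr 1
    ring

lemma coeff_specX_P_eq_treeSum (t : K) (T : BinaryTree Unit) (N : ℕ) :
    coeff N (specX t (P K T)) = coeff N (treeSum (N + 1) (letterWeight t) T 0 0) := by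
  rw [coeff_specX_P, treeSum, wordSum_eq_sum, map_sum,
    ← Equiv.sum_comp (Equiv.arrowProdEquivProdArrow _ _ _).symm, Fintype.sum_prod_type,
    Finset.sum_comm]
  refine Finset.sum_congr rfl fun f _ => Finset.sum_congr rfl fun ε _ => ?_
  have hword : (List.ofFn fun i => ((f i : ℕ), ε i)) =
      (List.range' 0 T.numNodes).map (extend fun i => ((f i : ℕ), ε i)) := by
    refine List.ext_getElem (by simp) fun i h₁ h₂ => ?_
    simp only [List.length_ofFn] at h₁
    simp [extend, h₁]
  have hcompat := isCompatible_iff (extend fun i => ((f i : ℕ), ε i)) T 0 0 0 (fun _ => True)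
    (fun _ _ _ _ => trivial) (by simp)
  rw [← hword] at hcompat
  simp only [implies_true, and_true] at hcompat
  have hprod : ∏ i, letterWeight t ((f i : ℕ), ε i) =
      X ^ (∑ i, (f i : ℕ)) * C (∏ i, signWeight t (ε i)) := by
    simp only [letterWeight]
    rw [Finset.prod_mul_distrib, Finset.prod_pow_eq_pow_sum, map_prod]
    congr 1
    refine Finset.prod_congr rfl fun i _ => ?_
    cases ε i <;> simp [signWeight]
  change _ = coeff N ((∏ i, letterWeight t ((f i : ℕ), ε i)) *
    if IsCompatible T 0 0 (List.ofFn fun i => ((f i : ℕ), ε i)) then 1 else 0)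
  rw [hprod, ← hcompat]
  by_cases h : IsCompatible T 0 0 (List.ofFn fun i => ((f i : ℕ), ε i))
  · simp only [h, true_and, if_true, mul_one]
    rw [coeff_mul_C, coeff_X_pow, ite_mul, one_mul, zero_mul]
    exact if_congr eq_comm rfl rfl
  · simp [h]

theorem specX_P_eq_thresholdSeries (t : K) (T : BinaryTree Unit) :
    specX t (P K T) = thresholdSeries t (unbarredSeries t T) T 0 0 := by
  ext N
  rw [coeff_specX_P_eq_treeSum, ← sub_eq_zero, ← map_sub]
  exact X_pow_dvd_iff.1 (X_pow_dvd_treeSum_sub t (N + 1) T 0 0) N (Nat.lt_succ_self N)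

/-- Formula (1) with denominators cleared, so that it holds in power series. -/
theorem specX_P_node (t : K) (u : Unit) (l r : BinaryTree Unit) :
    (1 - X ^ r.left.numNodes * C t) * (1 - X ^ (l.numNodes + r.numNodes + 1)) *
        specX t (P K (.node u l r)) =
      (X ^ r.numNodes - X ^ r.left.numNodes * C t) * (1 - X ^ l.numNodes * C t) *
        specX t (P K l) * specX t (P K r) := by
  -- Changing the bounds on the root of `r` from `(0, 0)` to `(1, 0)` changes only the explicit
  -- prefactor; for empty `r` both prefactors are `1 - t`.
  have hr : (1 - X ^ r.left.numNodes * C t) * thresholdSeries t (unbarredSeries t r) r 1 0 =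
      (X ^ r.numNodes - X ^ r.left.numNodes * C t) *
        thresholdSeries t (unbarredSeries t r) r 0 0 := by
    unfold thresholdSeries
    split_ifs with h
    · simp [h, BinaryTree.numNodes, BinaryTree.left]
    · simp only [zero_mul, one_mul, zero_add, pow_zero]
      ring
  have hinv := one_sub_X_pow_mul_inv (K := K) (Nat.succ_ne_zero (l.numNodes + r.numNodes))
  simp only [specX_P_eq_thresholdSeries]
  generalize r.left.numNodes = k at hr ⊢
  rw [thresholdSeries, if_neg (by simp), unbarredSeries]
  simp only [BinaryTree.numNodes, BinaryTree.left, zero_mul, zero_add, pow_zero,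
    Nat.succ_eq_add_one] at hinv ⊢
  generalize thresholdSeries t (unbarredSeries t r) r 1 0 = y at *
  linear_combination (1 - X ^ k * C t) * (1 - C t * X ^ l.numNodes) *
    thresholdSeries t (unbarredSeries t l) l 0 0 * y * hinv +
    (1 - C t * X ^ l.numNodes) * thresholdSeries t (unbarredSeries t l) l 0 0 * hr

theorem specX_P_nil (t : K) : specX t (P K .nil) = 1 := by
  rw [specX_P_eq_thresholdSeries, thresholdSeries, if_pos rfl]

end Series

/-! ### The hook-content formula -/

section HookContent

variable (𝕜 : Type*) [Field 𝕜]

lemma ofPowerSeries_one_sub_X_pow_mul_C (k : ℕ) :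
    HahnSeries.ofPowerSeries ℤ (RatFunc 𝕜)
      (1 - PowerSeries.X ^ k * PowerSeries.C (RatFunc.X : RatFunc 𝕜)) = 1 - q 𝕜 ^ k * t 𝕜 := by
  simp [q, t]

lemma one_sub_q_pow_mul_t_ne_zero (k : ℕ) : 1 - q 𝕜 ^ k * t 𝕜 ≠ 0 := by
  rw [← ofPowerSeries_one_sub_X_pow_mul_C]
  refine fun h => ?_
  rw [map_eq_zero_iff _ HahnSeries.ofPowerSeries_injective] at h
  have h' := congrArg PowerSeries.constantCoeff h
  -- The constant coefficient in `q` is `1 - t` for `k = 0`, nonzero as `t` is an indeterminate, and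
  -- `1` otherwise.
  rcases k with _ | k
  · have hX : (1 : RatFunc 𝕜) = RatFunc.X := by simpa [sub_eq_zero] using h'
    have : algebraMap (Polynomial 𝕜) (RatFunc 𝕜) 1 =
        algebraMap (Polynomial 𝕜) (RatFunc 𝕜) Polynomial.X := by
      simpa using hX
    have h₁ := congrArg (Polynomial.coeff · 1) (RatFunc.algebraMap_injective 𝕜 this)
    simp [Polynomial.coeff_one] at h₁
  · simp at h'

lemma one_sub_q_pow_ne_zero {n : ℕ} (hn : n ≠ 0) : 1 - q 𝕜 ^ n ≠ 0 := by
  have : 1 - q 𝕜 ^ n = HahnSeries.ofPowerSeries ℤ (RatFunc 𝕜) (1 - PowerSeries.X ^ n) := by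
    simp [q]
  rw [this]
  refine fun h => ?_
  rw [map_eq_zero_iff _ HahnSeries.ofPowerSeries_injective] at h
  have h' := congrArg PowerSeries.constantCoeff h
  simp [hn] at h'

lemma PX_nil : PX 𝕜 .nil = 1 := by
  rw [PX, specX_P_nil, map_one]

lemma PX_node (u : Unit) (l r : BinaryTree Unit) :
    PX 𝕜 (.node u l r) =
      ((q 𝕜 ^ r.numNodes - q 𝕜 ^ r.left.numNodes * t 𝕜) * (1 - q 𝕜 ^ l.numNodes * t 𝕜)) /
        ((1 - q 𝕜 ^ r.left.numNodes * t 𝕜) * (1 - q 𝕜 ^ (l.numNodes + r.numNodes + 1))) *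
        PX 𝕜 l * PX 𝕜 r := by
  have h := congrArg (HahnSeries.ofPowerSeries ℤ (RatFunc 𝕜))
    (specX_P_node (RatFunc.X : RatFunc 𝕜) u l r)
  simp only [map_mul, map_sub, map_one, map_pow, HahnSeries.ofPowerSeries_C] at h
  have h₁ := one_sub_q_pow_mul_t_ne_zero 𝕜 r.left.numNodes
  have h₂ := one_sub_q_pow_ne_zero 𝕜 (Nat.succ_ne_zero (l.numNodes + r.numNodes))
  rw [div_mul_eq_mul_div, div_mul_eq_mul_div, eq_div_iff (mul_ne_zero h₁ h₂), mul_comm]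
  exact h

/-- The hook-content factor of the node `s` of `T`, when `T` hangs at the end of a right branch
whose top node has a left subtree of size `d`. -/
noncomputable def branchContent (d : ℕ) (T : BinaryTree Unit) (s : List Bool) :
    LaurentSeries (RatFunc 𝕜) :=
  if (subtreeAt T s).right = .nil ∧ (∀ b ∈ s, b = true) then
    1 / (1 - q 𝕜 ^ (subtreeAt T s).numNodes) * (1 - q 𝕜 ^ d * t 𝕜)
  else hookContent 𝕜 T s

lemma subtreeAt_nil (T : BinaryTree Unit) : subtreeAt T [] = T := by
  rw [subtreeAt]

lemma subtreeAt_node_false (u : Unit) (l r : BinaryTree Unit) (s : List Bool) :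
    subtreeAt (.node u l r) (false :: s) = subtreeAt l s := rfl

lemma subtreeAt_node_true (u : Unit) (l r : BinaryTree Unit) (s : List Bool) :
    subtreeAt (.node u l r) (true :: s) = subtreeAt r s := rfl

lemma left_node (u : Unit) (l r : BinaryTree Unit) : (BinaryTree.node u l r).left = l := rfl

lemma topAncestor_eq_nil_iff (s : List Bool) : topAncestor s = [] ↔ ∀ b ∈ s, b = true := by
  rw [topAncestor, List.rdropWhile_eq_nil_iff]

lemma topAncestor_cons_of_ne_nil (b : Bool) {s : List Bool} (h : topAncestor s ≠ []) :
    topAncestor (b :: s) = b :: topAncestor s := by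
  simp only [topAncestor, List.rdropWhile, ne_eq, List.reverse_eq_nil_iff] at h ⊢
  rw [List.reverse_cons, List.dropWhile_append, if_neg (by simpa using h)]
  simp

lemma topAncestor_false_cons (s : List Bool) :
    topAncestor (false :: s) = false :: topAncestor s := by
  by_cases h : topAncestor s = []
  · simp only [topAncestor, List.rdropWhile, List.reverse_eq_nil_iff] at h ⊢
    rw [List.reverse_cons, List.dropWhile_append, if_pos (by simpa using h), h]
    simp
  · exact topAncestor_cons_of_ne_nil false h

lemma getLast?_eq_some_true {s : List Bool} (hs : s ≠ []) (h : ∀ b ∈ s, b = true) :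
    s.getLast? = some true := by
  rw [List.getLast?_eq_some_getLast hs, h _ (List.getLast_mem hs)]

lemma hookContent_node_false (u : Unit) (l r : BinaryTree Unit) (s : List Bool) :
    hookContent 𝕜 (.node u l r) (false :: s) = hookContent 𝕜 l s := by
  have hlast : (false :: s).getLast? = some true ↔ s.getLast? = some true := by
    cases s <;> simp
  simp only [hookContent, hlast, topAncestor_false_cons, subtreeAt_node_false]

lemma hookContent_node_true (u : Unit) (l r : BinaryTree Unit) (s : List Bool) :
    hookContent 𝕜 (.node u l r) (true :: s) = branchContent 𝕜 l.numNodes r s := by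
  unfold branchContent
  split_ifs with h
  · have htop : topAncestor (true :: s) = [] := (topAncestor_eq_nil_iff _).2 (by simpa using h.2)
    have hlast := getLast?_eq_some_true (List.cons_ne_nil true s) (by simpa using h.2)
    simp only [hookContent, htop, hlast, subtreeAt_node_true, subtreeAt_nil, left_node, if_true,
      h.1, ne_eq, not_true_eq_false, if_false]
  · by_cases hr : (subtreeAt r s).right = .nil
    · have hs : ¬ ∀ b ∈ s, b = true := fun h' => h ⟨hr, h'⟩
      have htop : topAncestor s ≠ [] := fun h' => hs ((topAncestor_eq_nil_iff s).1 h')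
      have hlast : (true :: s).getLast? = s.getLast? := by
        cases s with
        | nil => simp at hs
        | cons => rw [List.getLast?_cons_cons]
      simp only [hookContent, topAncestor_cons_of_ne_nil true htop, hlast, subtreeAt_node_true]
    · simp only [hookContent, subtreeAt_node_true, ne_eq, hr, not_false_eq_true, if_true]

/-- The root of `T` tops its own right branch. If it has no right son, `n_s - 1` is the size of its
left subtree, so the two cases of the formula agree. -/
lemma hookContent_eq_branchContent {T : BinaryTree Unit} (hT : T ≠ .nil) (s : List Bool) :
    hookContent 𝕜 T s = branchContent 𝕜 T.left.numNodes T s := by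
  unfold branchContent
  split_ifs with h
  · have htop : topAncestor s = [] := (topAncestor_eq_nil_iff _).2 h.2
    by_cases hs : s = []
    · subst hs
      cases T with
      | nil => exact absurd rfl hT
      | node u l r =>
        have hr : r = .nil := h.1
        subst hr
        simp [hookContent, subtreeAt, BinaryTree.right, BinaryTree.left, BinaryTree.numNodes]
    · simp only [hookContent, htop, getLast?_eq_some_true hs h.2, subtreeAt, if_true,
        h.1, ne_eq, not_true_eq_false, if_false]
  · rfl

lemma branchContent_node_false (d : ℕ) (u : Unit) (l r : BinaryTree Unit) (s : List Bool) :
    branchContent 𝕜 d (.node u l r) (false :: s) = hookContent 𝕜 l s := by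
  rw [branchContent, if_neg (by simp), hookContent_node_false]

lemma branchContent_node_true (d : ℕ) (u : Unit) (l r : BinaryTree Unit) (s : List Bool) :
    branchContent 𝕜 d (.node u l r) (true :: s) = branchContent 𝕜 d r s := by
  unfold branchContent
  simp only [subtreeAt_node_true, List.forall_mem_cons, true_and]
  split_ifs with h
  · rfl
  · rw [hookContent_node_true, branchContent, if_neg h]

lemma prod_nodes_node {M : Type*} [CommMonoid M] (u : Unit) (l r : BinaryTree Unit)
    (g : List Bool → M) :
    ∏ s ∈ nodes (.node u l r), g s =
      g [] * (∏ s ∈ nodes l, g (false :: s)) * ∏ s ∈ nodes r, g (true :: s) := by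
  rw [nodes, Finset.prod_union, Finset.prod_union, Finset.prod_singleton,
    Finset.prod_image (by simp), Finset.prod_image (by simp)]
  · simp
  · rw [Finset.disjoint_left]
    intro s hs hs'
    simp only [Finset.mem_union, Finset.mem_singleton, Finset.mem_image] at hs hs'
    obtain ⟨_, _, rfl⟩ := hs'
    simp at hs

/-- The second statement strengthens the induction: hanging `T` on a right branch only replaces the
factor at the bottom of its rightmost branch. The case where `d` is the size of the left subtree
gives back the first. -/
lemma prod_hookContent_eq (T : BinaryTree Unit) :
    ∏ s ∈ nodes T, hookContent 𝕜 T s = PX 𝕜 T ∧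
      (T ≠ .nil → ∀ d, ∏ s ∈ nodes T, branchContent 𝕜 d T s =
        (1 - q 𝕜 ^ d * t 𝕜) / (1 - q 𝕜 ^ T.left.numNodes * t 𝕜) * PX 𝕜 T) := by
  induction T with
  | nil => simp [nodes, PX_nil]
  | node u l r hl hr =>
    have key : ∀ d, ∏ s ∈ nodes (.node u l r), branchContent 𝕜 d (.node u l r) s =
        (1 - q 𝕜 ^ d * t 𝕜) / (1 - q 𝕜 ^ l.numNodes * t 𝕜) * PX 𝕜 (.node u l r) := by
      intro d
      have h₁ := one_sub_q_pow_mul_t_ne_zero 𝕜 l.numNodes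
      have h₁' : 1 - t 𝕜 * q 𝕜 ^ l.numNodes ≠ 0 := by rwa [mul_comm]
      have h₂ := one_sub_q_pow_mul_t_ne_zero 𝕜 r.left.numNodes
      have h₃ := one_sub_q_pow_ne_zero 𝕜 (Nat.succ_ne_zero (l.numNodes + r.numNodes))
      rw [Nat.succ_eq_add_one] at h₃
      rw [prod_nodes_node]
      simp_rw [branchContent_node_false, branchContent_node_true]
      rw [hl.1, PX_node]
      -- If `r` is empty the root is the bottom of the branch and takes the factor in `d`; otherwise
      -- `d` passes to `r`, whose denominator `1 - q^(#r.left)t` is the one in `PX_node`.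
      by_cases h : r = .nil
      · subst h
        simp only [branchContent, subtreeAt, BinaryTree.right, nodes, Finset.prod_empty, PX_nil,
          BinaryTree.numNodes, BinaryTree.left] at h₂ h₃ ⊢
        simp only [pow_zero, one_mul] at h₂ ⊢
        simp
        field_simp
      · rw [hr.2 h, branchContent, if_neg (by simp [subtreeAt, BinaryTree.right, h])]
        simp only [hookContent, subtreeAt, BinaryTree.right, ne_eq, h, not_false_eq_true, if_true]
        rw [BinaryTree.numNodes]
        field_simp
    refine ⟨?_, fun _ => key⟩
    rw [Finset.prod_congr rfl fun s _ => hookContent_eq_branchContent 𝕜 (by simp) s]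
    rw [BinaryTree.left, key, div_self (one_sub_q_pow_mul_t_ne_zero 𝕜 _), one_mul]

end HookContent

end SuperHook

theorem mainTheorem7 (𝕜 : Type*) [Field 𝕜] :
    (∀ T : BinaryTree Unit, T ≠ BinaryTree.nil →
      SuperHook.PX 𝕜 T =
        ((SuperHook.q 𝕜 ^ T.right.numNodes
            - SuperHook.q 𝕜 ^ T.right.left.numNodes * SuperHook.t 𝕜)
          * (1 - SuperHook.q 𝕜 ^ T.left.numNodes * SuperHook.t 𝕜))
        / ((1 - SuperHook.q 𝕜 ^ T.right.left.numNodes * SuperHook.t 𝕜)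
          * (1 - SuperHook.q 𝕜 ^ T.numNodes))
        * SuperHook.PX 𝕜 T.left * SuperHook.PX 𝕜 T.right) ∧
    (∀ T : BinaryTree Unit,
      SuperHook.PX 𝕜 T = ∏ s ∈ SuperHook.nodes T, SuperHook.hookContent 𝕜 T s) := by
  refine ⟨fun T hT => ?_, fun T => (SuperHook.prod_hookContent_eq 𝕜 T).1.symm⟩
  cases T with
  | nil => exact absurd rfl hT
  | node u l r => exact SuperHook.PX_node 𝕜 u l r
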